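/- Let $(W,S)$ be a Coxeter system of type $D_n$ ($n\ge 1$; $D_1$ is trivial, $D_2=A_1\times A_1$, $D_3=A_3$) or $E_8$, with length function $\ell$, set of reflections $T=\{wsw^{-1}: w\in W,\ s\in S\}$ and Bruhat order $\le$. For $u,v\in W$ put $D(u)=\{t\in T: ut<u\}$, $A(u)=\{t\in T: u<ut\}$, $AD(u,v)=A(u)\cap D(v)$, and $D_R(u)=\{s\in S:\ell(us)<\ell(u)\}$. For $r,t\in T$ write $r^t=trt$. Realize $W$ as a finite reflection group through its geometric representation, with simple roots $\alpha_s$ ($s\in S$), let $\alpha_t$ be the positive root corresponding to $t\in T$, and order $T$ by: $r\preceq t$ if $\alpha_t-\alpha_r$ is a linear combination of simple roots with nonnegative coefficients. Let $u,v\in W$ and let $t$ be a minimal element of $AD(u,v)$ with respect to $\preceq$. If $t\notin S$, then there exists $s\in S$ such that (1) $s\in D(t)$; (2) $s^t$ is minimal in $AD(us,vs)$ with respect to $\preceq$; (3) $s^t=t^s$. Moreover, $s$ can be chosen such that in addition $s\in D_R(v)$ if and only if $s\in D_R(u)$. -/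

import Mathlib

/-! ## The Coxeter matrix of type `D_n` -/

/-- Index set of the simple reflections of `D_n`, for `n ≥ 1`. In the realization of `D_n` by signed
permutations of `{1, …, n}` with an even number of signs, the index `k ≥ 1` stands for
the transposition `s_{k,k+1}`, and the index `0` stands for `t_{1,2} = [-2, -1, 3, …, n]`.
There is no simple reflection if `n ≤ 1`. -/
abbrev TypeDIndex (n : ℕ) : Type := {_k : Fin n // 2 ≤ n}

/-- The bonds (in one direction) of the Coxeter graph of type `D_n`: the path
`1 — 2 — 3 — ⋯ — (n-1)`, together with the bond `0 — 2`. -/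
def typeDBond (a b : ℕ) : Prop := (1 ≤ a ∧ a + 1 = b) ∨ (a = 0 ∧ b = 2)

instance (a b : ℕ) : Decidable (typeDBond a b) := by unfold typeDBond; infer_instance

/-- The Coxeter matrix of type `D_n`. (`D_2 = A_1 × A_1` and `D_3 = A_3` are included.) -/
def typeDMatrix (n : ℕ) : CoxeterMatrix (TypeDIndex n) where
  M := Matrix.of fun i j =>
    if i = j then 1 else if typeDBond i.1 j.1 ∨ typeDBond j.1 i.1 then 3 else 2
  isSymm := by
    ext i j
    simp only [Matrix.transpose_apply, Matrix.of_apply, eq_comm (a := i) (b := j),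
      or_comm (a := typeDBond i.1 j.1)]
  diagonal i := by simp
  off_diagonal i j h := by
    simp only [Matrix.of_apply, if_neg h]
    split_ifs <;> decide

/-- `M` is, up to the naming of the simple reflections, the Coxeter matrix of type `D_n` for
some `n`, or the Coxeter matrix of type `E_8`. -/
def IsTypeDOrE8 {B : Type*} (M : CoxeterMatrix B) : Prop :=
  (∃ (n : ℕ) (e : TypeDIndex n ≃ B), M = (typeDMatrix n).reindex e) ∨
    (∃ e : Fin 8 ≃ B, M = CoxeterMatrix.E₈.reindex e)

/-! ## The geometric representation of a Coxeter system -/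

namespace CoxeterMatrix

open Polynomial.Chebyshev

variable {B : Type*} (M : CoxeterMatrix B)

/-- The simple root `α_i`: the basis vectors of `V = B →₀ ℝ` are the simple roots. -/
noncomputable def simpleRoot (i : B) : B →₀ ℝ := Finsupp.single i 1

/-- The linear form `x ↦ 2 (α_i, x)` on `V`, where `( , )` is the canonical symmetric
bilinear form `(α_i, α_j) = - cos (π / m_{ij})`. (For `m_{ij} = 0`, which encodes `m_{ij} = ∞`,
the value is `-1`, as usual.) -/
noncomputable def simpleCoroot (i : B) : Module.Dual ℝ (B →₀ ℝ) :=
  Finsupp.linearCombination ℝ fun j => -2 * Real.cos (Real.pi / (M i j : ℝ))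

theorem simpleCoroot_simpleRoot (i j : B) :
    M.simpleCoroot i (simpleRoot j) = -2 * Real.cos (Real.pi / (M i j : ℝ)) := by
  simp [simpleCoroot, simpleRoot]

theorem simpleCoroot_simpleRoot_self (i : B) : M.simpleCoroot i (simpleRoot i) = 2 := by
  simp [simpleCoroot_simpleRoot]

/-- The reflection `σ_i x = x - 2 (α_i, x) α_i` of `V`. -/
noncomputable def simpleReflection (i : B) : (B →₀ ℝ) ≃ₗ[ℝ] (B →₀ ℝ) :=
  Module.reflection (M.simpleCoroot_simpleRoot_self i)

/-- The coefficients in the formula for the `m`-th power of a product of two reflections vanish at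
`t = 2 cos (2π / m)`. -/
theorem chebyshev_coeff_eq_zero (m : ℕ) (h2 : 3 ≤ m) (t : ℝ)
    (ht : t = 2 * Real.cos (2 * (Real.pi / m))) :
    (S ℝ (((m : ℤ) - 2) / 2)).eval t *
        ((S ℝ (((m : ℤ) - 1) / 2)).eval t + (S ℝ (((m : ℤ) - 3) / 2)).eval t) = 0 ∧
      (S ℝ (((m : ℤ) - 1) / 2)).eval t *
        ((S ℝ ((m : ℤ) / 2)).eval t + (S ℝ (((m : ℤ) - 2) / 2)).eval t) = 0 := by
  have hm : (3 : ℝ) ≤ m := by exact_mod_cast h2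
  set θ := 2 * (Real.pi / m) with hθ
  have hmθ : (m : ℝ) * θ = 2 * Real.pi := by rw [hθ]; field_simp
  have hpi := Real.pi_pos
  have hsin : Real.sin θ ≠ 0 := by
    apply ne_of_gt
    apply Real.sin_pos_of_pos_of_lt_pi
    · positivity
    · nlinarith
  have key (n : ℤ) : (S ℝ n).eval t = Real.sin ((n + 1) * θ) / Real.sin θ := by
    rw [eq_div_iff hsin, ht, Polynomial.Chebyshev.S_two_mul_real_cos]
  rcases Nat.even_or_odd' m with ⟨k, rfl | rfl⟩
  · have e1 : ((2 * k : ℕ) - 2 : ℤ) / 2 = k - 1 := by omega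
    have e2 : ((2 * k : ℕ) - 1 : ℤ) / 2 = k - 1 := by omega
    have h0 : (S ℝ (k - 1 : ℤ)).eval t = 0 := by
      rw [key]
      have : ((((k : ℤ) - 1 : ℤ) : ℝ) + 1) * θ = Real.pi := by push_cast at hmθ ⊢; linarith
      rw [this]; simp
    rw [e1, e2, h0]; simp
  · have e1 : ((2 * k + 1 : ℕ) - 2 : ℤ) / 2 = k - 1 := by omega
    have e2 : ((2 * k + 1 : ℕ) - 1 : ℤ) / 2 = k := by omega
    have e3 : ((2 * k + 1 : ℕ) - 3 : ℤ) / 2 = k - 1 := by omega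
    have e4 : ((2 * k + 1 : ℕ) : ℤ) / 2 = k := by omega
    have h0 : (S ℝ (k : ℤ)).eval t + (S ℝ (k - 1 : ℤ)).eval t = 0 := by
      rw [key, key]
      have : ((((k : ℤ)  : ℤ) : ℝ) + 1) * θ = 2 * Real.pi - ((((k : ℤ) - 1 : ℤ) : ℝ) + 1) * θ := by
        push_cast at hmθ ⊢; linarith
      rw [this, Real.sin_two_pi_sub]; ring
    rw [e1, e2, e3, e4, h0]; simp

theorem isLiftable_simpleReflection : M.IsLiftable M.simpleReflection := by
  intro i j
  obtain h | h | h | h : M i j = 0 ∨ M i j = 1 ∨ M i j = 2 ∨ 3 ≤ M i j := by omega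
  · rw [h, pow_zero]
  · have hij : i = j := by
      by_contra hij
      exact M.off_diagonal i j hij h
    subst hij
    rw [h, pow_one]
    ext1 x
    exact Module.involutive_reflection (M.simpleCoroot_simpleRoot_self i) x
  · have e1 : M.simpleCoroot i (simpleRoot j) = 0 := by simp [simpleCoroot_simpleRoot, h]
    have e2 : M.simpleCoroot j (simpleRoot i) = 0 := by
      simp [simpleCoroot_simpleRoot, M.symmetric j i, h]
    have e3 := M.simpleCoroot_simpleRoot_self
    rw [h]
    ext1 x
    simp only [simpleReflection, pow_two, LinearEquiv.mul_apply, Module.reflection_apply, map_sub,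
      map_smul, e1, e2, e3, LinearEquiv.coe_one, id]
    module
  · apply LinearEquiv.toLinearMap_injective
    obtain ⟨h1, h2⟩ := chebyshev_coeff_eq_zero (M i j) h _ rfl
    unfold simpleReflection
    rw [Module.reflection_mul_reflection_pow (M.simpleCoroot_simpleRoot_self i)
      (M.simpleCoroot_simpleRoot_self j) (M i j)
      (2 * Real.cos (2 * (Real.pi / (M i j : ℝ)))) (by
        rw [simpleCoroot_simpleRoot, simpleCoroot_simpleRoot, M.symmetric j i, Real.cos_two_mul]
        ring), h1, h2]
    simp

end CoxeterMatrix

namespace CoxeterSystem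

variable {B W : Type*} [Group W] {M : CoxeterMatrix B} (cs : CoxeterSystem M W)

/-- The geometric representation `W → GL(V)`, `s_i ↦ σ_i`, which realizes `W` as
a reflection group on `V = B →₀ ℝ` with base the simple roots. -/
noncomputable def geomRep : W →* ((B →₀ ℝ) ≃ₗ[ℝ] (B →₀ ℝ)) :=
  cs.lift ⟨M.simpleReflection, M.isLiftable_simpleReflection⟩

/-- `α` is the positive root `α_t` of the reflection `t`: for some `w` and `i` we have
`t = w s_i w⁻¹` and `α = w(α_i)`, and `α` has nonnegative coefficients on the simple roots. -/
def IsPosRoot (t : W) (α : B →₀ ℝ) : Prop :=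
  (∃ (w : W) (i : B), t = w * cs.simple i * w⁻¹ ∧
    α = cs.geomRep w (CoxeterMatrix.simpleRoot i)) ∧ 0 ≤ α

/-- The partial order `≼` on reflections: `r ≼ t` if `α_t - α_r` is
a linear combination of simple roots with nonnegative coefficients. (The order on
`B →₀ ℝ` is coordinatewise.) -/
def ReflLE (r t : W) : Prop :=
  ∃ α β : B →₀ ℝ, cs.IsPosRoot r α ∧ cs.IsPosRoot t β ∧ 0 ≤ β - α

/-! ## Bruhat order and the sets `D(u)`, `A(u)`, `AD(u, v)` -/

/-- Bruhat order: the reflexive and transitive closure of the relation `u → ut`, where `t` is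
a reflection with `ℓ(u) < ℓ(ut)`. -/
def BruhatLE : W → W → Prop :=
  Relation.ReflTransGen fun x y =>
    ∃ t, cs.IsReflection t ∧ y = x * t ∧ cs.length x < cs.length y

/-- Strict Bruhat order. -/
def BruhatLT (u v : W) : Prop := cs.BruhatLE u v ∧ u ≠ v

/-- `D(u) = {t ∈ T : ut < u}`. -/
def descSet (u : W) : Set W := {t | cs.IsReflection t ∧ cs.BruhatLT (u * t) u}

/-- `A(u) = {t ∈ T : u < ut}`. -/
def ascSet (u : W) : Set W := {t | cs.IsReflection t ∧ cs.BruhatLT u (u * t)}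

/-- `AD(u, v) = A(u) ∩ D(v)`. -/
def ascDescSet (u v : W) : Set W := cs.ascSet u ∩ cs.descSet v

/-- `t` is a minimal element of the set `X` of reflections with respect to `≼`. -/
def IsMinimalRefl (X : Set W) (t : W) : Prop := t ∈ X ∧ ∀ r ∈ X, cs.ReflLE r t → r = t

end CoxeterSystem

/-! Everything is read off from roots. If `β` is the positive root of `t`, then `t ∈ AD(u,v)` means
`uβ ≥ 0` and `vβ ≤ 0` (`mem_ascDescSet_iff`).

Since `(β,β) > 0` and `β` is a nonnegative combination of simple roots, some simple root `α` of a
reflection `s` pairs positively with `β`. The form is positive definite and the type simply laced,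
so the pairing is `1`. Hence `sβ = β - α` and `tα = α - β`: both `sts` and `tst` have root `β - α`,
and `s ∈ D(t)`.

Now `β` is the sum of the positive roots `α` and `β - α`. If exactly one of `uα`, `vα` is negative,
then `s` or `sts` lies in `AD(u,v)` below `t`, against minimality. This gives the descent
equivalence. If `r ∈ AD(us,vs)` has root `γ ≤ β - α`, the equivalence excludes `r = s`, so `sγ` is a
positive root; it is at most `β` because `(α,γ) ≥ -1`, and minimality forces `srs = t`.

Types `D_n` and `E_8` enter only through being simply laced and positive definite; the latter is
certified by the half sum of the positive roots. -/

/-! ## The invariant form of a simply laced Coxeter matrix -/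

namespace CoxeterMatrix

variable {B : Type*} (M : CoxeterMatrix B)

/-- A Coxeter matrix is simply laced if all its off-diagonal entries are `2` or `3`. -/
def IsSimplyLaced : Prop := ∀ i j, i ≠ j → M i j = 2 ∨ M i j = 3

/-- Twice the canonical bilinear form, so that `form α_i x` is `simpleCoroot i x`. -/
noncomputable def form : (B →₀ ℝ) →ₗ[ℝ] Module.Dual ℝ (B →₀ ℝ) :=
  Finsupp.linearCombination ℝ M.simpleCoroot

/-- The canonical bilinear form is positive definite. -/
def IsPosDef : Prop := ∀ x : B →₀ ℝ, x ≠ 0 → 0 < M.form x x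

@[simp] theorem form_simpleRoot (i : B) : M.form (simpleRoot i) = M.simpleCoroot i := by
  simp [form, simpleRoot]

theorem form_comm (x y : B →₀ ℝ) : M.form x y = M.form y x := by
  suffices h : M.form = M.form.flip from LinearMap.congr_fun₂ h x y
  ext i j
  simp only [LinearMap.coe_comp, Function.comp_apply, Finsupp.lsingle_apply, LinearMap.flip_apply]
  change M.form (simpleRoot i) (simpleRoot j) = M.form (simpleRoot j) (simpleRoot i)
  rw [form_simpleRoot, form_simpleRoot, simpleCoroot_simpleRoot, simpleCoroot_simpleRoot,
    M.symmetric]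

theorem simpleReflection_apply (i : B) (x : B →₀ ℝ) :
    M.simpleReflection i x = x - M.simpleCoroot i x • simpleRoot i :=
  Module.reflection_apply x (M.simpleCoroot_simpleRoot_self i)

theorem form_simpleReflection (i : B) (x y : B →₀ ℝ) :
    M.form (M.simpleReflection i x) (M.simpleReflection i y) = M.form x y := by
  have h : ∀ z, M.form z (simpleRoot i) = M.simpleCoroot i z := fun z => by
    rw [form_comm, form_simpleRoot]
  simp only [simpleReflection_apply, map_sub, map_smul, LinearMap.sub_apply, LinearMap.smul_apply,
    form_simpleRoot, h, simpleCoroot_simpleRoot_self, smul_eq_mul]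
  ring

theorem simpleRoot_nonneg (i : B) : 0 ≤ simpleRoot i := by
  classical
  intro j
  rw [simpleRoot, Finsupp.single_apply]
  split_ifs <;> simp

theorem simpleRoot_ne_zero (i : B) : simpleRoot i ≠ 0 := by simp [simpleRoot]

theorem form_apply (x y : B →₀ ℝ) :
    M.form x y = x.sum fun i a => a * M.simpleCoroot i y := by
  simp [form, Finsupp.linearCombination_apply, Finsupp.sum]

variable {M}

theorem IsSimplyLaced.simpleCoroot_simpleRoot_of_ne (hM : M.IsSimplyLaced) {i j : B}
    (h : i ≠ j) : M.simpleCoroot i (simpleRoot j) = if M i j = 3 then -1 else 0 := by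
  rw [CoxeterMatrix.simpleCoroot_simpleRoot]
  rcases hM i j h with h | h <;> simp [h]

/-- The root lattice. -/
noncomputable def rootLattice (B : Type*) : AddSubgroup (B →₀ ℝ) :=
  AddSubgroup.closure (Set.range simpleRoot)

theorem simpleRoot_mem_rootLattice (i : B) : simpleRoot i ∈ rootLattice B :=
  AddSubgroup.subset_closure ⟨i, rfl⟩

theorem IsSimplyLaced.exists_int_simpleCoroot (hM : M.IsSimplyLaced) (i : B) {x : B →₀ ℝ}
    (hx : x ∈ rootLattice B) : ∃ n : ℤ, M.simpleCoroot i x = n := by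
  induction hx using AddSubgroup.closure_induction with
  | mem x hx =>
    obtain ⟨j, rfl⟩ := hx
    by_cases h : i = j
    · subst h
      exact ⟨2, by rw [simpleCoroot_simpleRoot_self]; norm_num⟩
    · rw [hM.simpleCoroot_simpleRoot_of_ne h]
      split_ifs
      exacts [⟨-1, by simp⟩, ⟨0, by simp⟩]
  | zero => exact ⟨0, by simp⟩
  | add x y _ _ hx hy =>
    obtain ⟨a, ha⟩ := hx
    obtain ⟨b, hb⟩ := hy
    exact ⟨a + b, by simp [ha, hb]⟩
  | neg x _ hx =>
    obtain ⟨a, ha⟩ := hx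
    exact ⟨-a, by simp [ha]⟩

theorem IsSimplyLaced.simpleReflection_mem_rootLattice (hM : M.IsSimplyLaced) (i : B)
    {x : B →₀ ℝ} (hx : x ∈ rootLattice B) : M.simpleReflection i x ∈ rootLattice B := by
  obtain ⟨n, hn⟩ := hM.exists_int_simpleCoroot i hx
  rw [simpleReflection_apply, hn, Int.cast_smul_eq_zsmul]
  exact sub_mem hx (zsmul_mem (simpleRoot_mem_rootLattice i) n)

theorem IsPosDef.form_lt_two (hM : M.IsPosDef) {x y : B →₀ ℝ} (hx : M.form x x = 2)
    (hy : M.form y y = 2) (h : x ≠ y) : M.form x y < 2 := by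
  have := hM (x - y) (sub_ne_zero.2 h)
  simp only [map_sub, LinearMap.sub_apply, hx, hy, M.form_comm y x] at this
  linarith

theorem IsPosDef.neg_two_lt_form (hM : M.IsPosDef) {x y : B →₀ ℝ} (hx : M.form x x = 2)
    (hy : M.form y y = 2) (h : x ≠ -y) : -2 < M.form x y := by
  have := hM.form_lt_two (y := -y) hx (by simpa using hy) h
  rw [map_neg] at this
  linarith

end CoxeterMatrix

/-! ## Roots and lengths -/

namespace CoxeterSystem

open CoxeterMatrix

variable {B W : Type*} [Group W] {M : CoxeterMatrix B} (cs : CoxeterSystem M W)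

theorem geomRep_simple (i : B) (x : B →₀ ℝ) :
    cs.geomRep (cs.simple i) x = x - M.simpleCoroot i x • simpleRoot i := by
  rw [geomRep, lift_apply_simple, simpleReflection_apply]

theorem geomRep_mul (u v : W) (x : B →₀ ℝ) :
    cs.geomRep (u * v) x = cs.geomRep u (cs.geomRep v x) := by
  rw [map_mul, LinearEquiv.mul_apply]

theorem geomRep_simple_simpleRoot (i : B) :
    cs.geomRep (cs.simple i) (simpleRoot i) = -simpleRoot i := by
  rw [geomRep_simple, simpleCoroot_simpleRoot_self]
  module

theorem geomRep_mul_simple_simpleRoot (w : W) (i : B) :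
    cs.geomRep (w * cs.simple i) (simpleRoot i) = -cs.geomRep w (simpleRoot i) := by
  rw [geomRep_mul, geomRep_simple_simpleRoot, map_neg]

theorem geomRep_ne_zero (w : W) {x : B →₀ ℝ} (hx : x ≠ 0) : cs.geomRep w x ≠ 0 := by
  simpa using hx

theorem form_geomRep (w : W) (x y : B →₀ ℝ) :
    M.form (cs.geomRep w x) (cs.geomRep w y) = M.form x y := by
  induction w using cs.simple_induction_left with
  | one => simp
  | mul_simple_left w i ih =>
    rw [geomRep_mul, geomRep_mul, geomRep, lift_apply_simple, form_simpleReflection]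
    exact ih

theorem geomRep_mem_rootLattice (hM : M.IsSimplyLaced) (w : W) {x : B →₀ ℝ}
    (hx : x ∈ rootLattice B) : cs.geomRep w x ∈ rootLattice B := by
  induction w using cs.simple_induction_left with
  | one => simpa
  | mul_simple_left w i ih =>
    rw [geomRep_mul, geomRep, lift_apply_simple]
    exact hM.simpleReflection_mem_rootLattice i ih

/-- A simple root that is not a right descent of `w` is mapped to a positive root by `w`. -/
theorem geomRep_simpleRoot_nonneg (hM : M.IsSimplyLaced) (w : W) (i : B)
    (h : cs.length w < cs.length (w * cs.simple i)) : 0 ≤ cs.geomRep w (simpleRoot i) := by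
  induction hn : cs.length w using Nat.strong_induction_on generalizing w i with
  | _ n ih =>
  subst hn
  by_cases hw : w = 1
  · subst hw
    simpa using simpleRoot_nonneg i
  obtain ⟨j, hj⟩ := cs.exists_rightDescent_of_ne_one hw
  rw [isRightDescent_iff] at hj
  obtain ⟨w, rfl⟩ : ∃ w', w = w' * cs.simple j := ⟨w * cs.simple j, by simp⟩
  rw [simple_mul_simple_cancel_right] at hj
  have hij : i ≠ j := by
    rintro rfl
    rw [simple_mul_simple_cancel_right] at h
    omega
  have key := hM.simpleCoroot_simpleRoot_of_ne hij.symm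
  have hmi := cs.length_mul_simple w i
  have hj0 := ih _ (by omega) w j (by omega) rfl
  rcases hM j i hij.symm with hm | hm
  -- If `s_i` and `s_j` commute, `s_j` fixes `α_i`, and `i` cannot be a descent of the shorter
  -- element.
  · have hcomm : cs.simple j * cs.simple i = cs.simple i * cs.simple j := by
      have := cs.simple_mul_simple_pow j i
      rw [hm, pow_two, mul_eq_one_iff_eq_inv] at this
      rw [this, mul_inv_rev, inv_simple, inv_simple]
    rw [geomRep_mul, geomRep_simple, key, if_neg (by omega), zero_smul, sub_zero]
    refine ih _ (by omega) w i ?_ rfl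
    rw [mul_assoc, hcomm, ← mul_assoc] at h
    have := cs.length_mul_simple (w * cs.simple i) j
    omega
  · rw [if_pos hm] at key
    rw [geomRep_mul, geomRep_simple, key, neg_one_smul, sub_neg_eq_add]
    -- For a bond, `s_j α_i = α_i + α_j`; induction applies to both summands unless `w` ends in
    -- `s_i`. In that case `s_i s_j α_i = α_j`, and by the braid relation a descent at `j` of what
    -- remains would contradict `h`.
    by_cases hc : cs.length w < cs.length (w * cs.simple i)
    · rw [map_add]
      exact add_nonneg (ih _ (by omega) w i hc rfl) hj0
    obtain ⟨w, rfl⟩ : ∃ w', w = w' * cs.simple i := ⟨w * cs.simple i, by simp⟩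
    rw [simple_mul_simple_cancel_right] at hmi hc
    have key' := hM.simpleCoroot_simpleRoot_of_ne hij
    rw [if_pos (M.symmetric i j ▸ hm)] at key'
    rw [geomRep_mul, geomRep_simple, map_add, simpleCoroot_simpleRoot_self, key',
      show simpleRoot i + simpleRoot j - (2 + -1 : ℝ) • simpleRoot i = (simpleRoot j : B →₀ ℝ) by
        module]
    refine ih _ (by omega) w j ?_ rfl
    have braid : cs.simple i * cs.simple j * cs.simple i =
        cs.simple j * cs.simple i * cs.simple j := by
      have := cs.simple_mul_simple_pow j i
      rw [hm, pow_succ, pow_two, show cs.simple j * cs.simple i * (cs.simple j * cs.simple i) *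
        (cs.simple j * cs.simple i) = (cs.simple j * cs.simple i * cs.simple j) *
          (cs.simple i * cs.simple j * cs.simple i) by simp only [mul_assoc],
        mul_eq_one_iff_eq_inv] at this
      rw [this]
      simp [mul_assoc]
    rw [show w * cs.simple i * cs.simple j * cs.simple i =
      w * cs.simple j * cs.simple i * cs.simple j by
        simpa only [mul_assoc] using congrArg (w * ·) braid] at h
    have h1 := cs.length_mul_simple (w * cs.simple j * cs.simple i) j
    have h2 := cs.length_mul_simple (w * cs.simple j) i
    omega

theorem geomRep_simpleRoot_nonpos (hM : M.IsSimplyLaced) (w : W) (i : B)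
    (h : cs.IsRightDescent w i) : cs.geomRep w (simpleRoot i) ≤ 0 := by
  have := cs.geomRep_simpleRoot_nonneg hM (w * cs.simple i) i
    (by rwa [simple_mul_simple_cancel_right])
  rwa [geomRep_mul_simple_simpleRoot, Left.nonneg_neg_iff] at this

theorem geomRep_simpleRoot_nonneg_or_nonpos (hM : M.IsSimplyLaced) (w : W) (i : B) :
    0 ≤ cs.geomRep w (simpleRoot i) ∨ cs.geomRep w (simpleRoot i) ≤ 0 := by
  by_cases h : cs.IsRightDescent w i
  · exact .inr (cs.geomRep_simpleRoot_nonpos hM w i h)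
  · rw [not_isRightDescent_iff] at h
    exact .inl (cs.geomRep_simpleRoot_nonneg hM w i (by omega))

/-- A nontrivial element has a right descent, whose simple root it makes negative. -/
theorem geomRep_injective (hM : M.IsSimplyLaced) : Function.Injective cs.geomRep := by
  rw [injective_iff_map_eq_one]
  intro w hw
  by_contra hne
  obtain ⟨i, hi⟩ := cs.exists_rightDescent_of_ne_one hne
  have := cs.geomRep_simpleRoot_nonpos hM w i hi
  rw [hw, LinearEquiv.coe_one, id] at this
  exact simpleRoot_ne_zero i (le_antisymm this (simpleRoot_nonneg i))

theorem geomRep_conj_simple (w : W) (i : B) (x : B →₀ ℝ) :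
    cs.geomRep (w * cs.simple i * w⁻¹) x =
      x - M.form (cs.geomRep w (simpleRoot i)) x • cs.geomRep w (simpleRoot i) := by
  obtain ⟨y, rfl⟩ := (cs.geomRep w).surjective x
  rw [form_geomRep, geomRep_mul, geomRep_mul, ← geomRep_mul _ w⁻¹ w, inv_mul_cancel, map_one,
    LinearEquiv.coe_one, id, geomRep_simple, map_sub, map_smul, form_simpleRoot]

theorem isPosRoot_simple (i : B) : cs.IsPosRoot (cs.simple i) (simpleRoot i) :=
  ⟨⟨1, i, by simp, by simp⟩, simpleRoot_nonneg i⟩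

theorem IsReflection.exists_isPosRoot {t : W} (ht : cs.IsReflection t) (hM : M.IsSimplyLaced) :
    ∃ β, cs.IsPosRoot t β := by
  obtain ⟨w, i, rfl⟩ := ht
  rcases cs.geomRep_simpleRoot_nonneg_or_nonpos hM w i with h | h
  · exact ⟨_, ⟨w, i, rfl, rfl⟩, h⟩
  · refine ⟨_, ⟨w * cs.simple i, i, by simp [mul_assoc], rfl⟩, ?_⟩
    rwa [geomRep_mul_simple_simpleRoot, Left.nonneg_neg_iff]

namespace IsPosRoot

variable {cs} {t r : W} {β γ : B →₀ ℝ}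

theorem isReflection (h : cs.IsPosRoot t β) : cs.IsReflection t := by
  obtain ⟨⟨w, i, rfl, -⟩, -⟩ := h
  exact ⟨w, i, rfl⟩

theorem form_self (h : cs.IsPosRoot t β) : M.form β β = 2 := by
  obtain ⟨⟨w, i, -, rfl⟩, -⟩ := h
  rw [form_geomRep, form_simpleRoot, simpleCoroot_simpleRoot_self]

theorem ne_zero (h : cs.IsPosRoot t β) : β ≠ 0 := by
  rintro rfl
  simpa using h.form_self

theorem mem_rootLattice (h : cs.IsPosRoot t β) (hM : M.IsSimplyLaced) : β ∈ rootLattice B := by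
  obtain ⟨⟨w, i, -, rfl⟩, -⟩ := h
  exact cs.geomRep_mem_rootLattice hM w (simpleRoot_mem_rootLattice i)

theorem geomRep_apply (h : cs.IsPosRoot t β) (x : B →₀ ℝ) :
    cs.geomRep t x = x - M.form β x • β := by
  obtain ⟨⟨w, i, rfl, rfl⟩, -⟩ := h
  exact cs.geomRep_conj_simple w i x

theorem geomRep_nonneg_or_nonpos (h : cs.IsPosRoot t β) (hM : M.IsSimplyLaced) (u : W) :
    0 ≤ cs.geomRep u β ∨ cs.geomRep u β ≤ 0 := by
  obtain ⟨⟨w, i, -, rfl⟩, -⟩ := h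
  rw [← geomRep_mul]
  exact cs.geomRep_simpleRoot_nonneg_or_nonpos hM _ i

/-- The positive root of a reflection is unique. -/
theorem unique (hβ : cs.IsPosRoot t β) (hγ : cs.IsPosRoot t γ) : β = γ := by
  have h1 : cs.geomRep t β = -β := by
    rw [hβ.geomRep_apply, hβ.form_self]
    module
  rw [hγ.geomRep_apply] at h1
  -- Comparing the two formulas for `tβ` makes the roots proportional; the norm leaves only a sign,
  -- which positivity fixes.
  have h2 : (2 : ℝ) • β = M.form γ β • γ := by
    rw [two_smul]
    rw [sub_eq_iff_eq_add, neg_add_eq_sub, eq_sub_iff_add_eq] at h1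
    exact h1
  have h3 : M.form γ β ^ 2 = 4 := by
    have := congrArg (M.form β) h2
    rw [map_smul, map_smul, hβ.form_self, M.form_comm β γ, smul_eq_mul, smul_eq_mul] at this
    linarith
  have h4 : M.form γ β = 2 ∨ M.form γ β = -2 := by
    rw [← sq_eq_sq_iff_eq_or_eq_neg, h3]
    norm_num
  rcases h4 with h4 | h4
  · rw [h4] at h2
    exact smul_right_injective _ two_ne_zero h2
  · rw [h4] at h2
    have h5 : β = -γ := smul_right_injective _ (two_ne_zero (α := ℝ)) (by simpa using h2)
    have h6 : β ≤ 0 := by rw [h5, neg_nonpos]; exact hγ.2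
    exact absurd (le_antisymm h6 hβ.2) hβ.ne_zero

/-- A reflection is determined by its positive root. -/
theorem reflection_unique (hM : M.IsSimplyLaced) (ht : cs.IsPosRoot t β) (hr : cs.IsPosRoot r β) :
    t = r := by
  apply cs.geomRep_injective hM
  ext1 x
  rw [ht.geomRep_apply, hr.geomRep_apply]

theorem conj (h : cs.IsPosRoot t β) (w : W) (hw : 0 ≤ cs.geomRep w β) :
    cs.IsPosRoot (w * t * w⁻¹) (cs.geomRep w β) := by
  obtain ⟨⟨u, i, rfl, rfl⟩, -⟩ := h
  exact ⟨⟨w * u, i, by simp [mul_assoc], by rw [geomRep_mul]⟩, hw⟩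

/-- Strip letters from the left of `u`. If `s_j` makes the positive root `δ` negative, then `δ =
α_j`; so `t` is conjugate to `s_j` by the stripped element, and multiplying by `t` shortens `u`. -/
theorem geomRep_nonneg_of_length_lt (hM : M.IsSimplyLaced) (h : cs.IsPosRoot t β) (u : W)
    (hu : cs.length u < cs.length (u * t)) : 0 ≤ cs.geomRep u β := by
  induction hn : cs.length u using Nat.strong_induction_on generalizing u with
  | _ n ih =>
  subst hn
  by_cases h1 : u = 1
  · subst h1
    simpa using h.2
  obtain ⟨j, hj⟩ := cs.exists_leftDescent_of_ne_one h1
  rw [isLeftDescent_iff] at hj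
  obtain ⟨u, rfl⟩ : ∃ u', u = cs.simple j * u' := ⟨cs.simple j * u, by simp⟩
  rw [simple_mul_simple_cancel_left] at hj
  rw [mul_assoc] at hu
  have hlen := cs.length_simple_mul (u * t) j
  have hpos := ih _ (by omega) u (by omega) rfl
  have hconj := h.conj u hpos
  refine (h.geomRep_nonneg_or_nonpos hM _).resolve_right fun hneg => ?_
  have hne : u * t * u⁻¹ ≠ cs.simple j := by
    intro he
    have : cs.simple j * (u * t) = u := by rw [← he]; simp [mul_assoc, h.isReflection.mul_self]
    rw [this] at hu
    omega
  apply hne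
  rw [geomRep_mul, geomRep_simple] at hneg
  set δ := cs.geomRep u β
  -- `s_j` changes only the coordinate at `j`, so every other coordinate of `δ` is both nonnegative
  -- and nonpositive.
  have hcoord : ∀ k, k ≠ j → δ k = 0 := fun k hk => by
    refine le_antisymm ?_ (hpos k)
    simpa [simpleRoot, hk.symm] using hneg k
  have hδ : δ = δ j • simpleRoot j := by
    classical
    ext k
    by_cases hk : k = j
    · subst hk
      simp [simpleRoot]
    · simp [simpleRoot, hcoord k hk, Finsupp.single_eq_of_ne hk]
  have hsq : δ j ^ 2 = 1 := by
    have := hconj.form_self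
    rw [hδ, map_smul, map_smul, LinearMap.smul_apply, form_simpleRoot,
      simpleCoroot_simpleRoot_self, smul_eq_mul, smul_eq_mul] at this
    linarith
  have hδj : δ j = 1 := by
    have h0 : 0 ≤ δ j := hpos j
    nlinarith
  rw [hδj, one_smul] at hδ
  exact reflection_unique hM hconj (hδ ▸ cs.isPosRoot_simple j)

theorem length_mul_lt_iff (hM : M.IsSimplyLaced) (h : cs.IsPosRoot t β) (u : W) :
    cs.length (u * t) < cs.length u ↔ cs.geomRep u β ≤ 0 := by
  have h1 : cs.geomRep t β = -β := by
    rw [h.geomRep_apply, h.form_self]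
    module
  constructor
  · intro hlt
    have := h.geomRep_nonneg_of_length_lt hM (u * t)
      (by rwa [mul_assoc, h.isReflection.mul_self, mul_one])
    rwa [geomRep_mul, h1, map_neg, Left.nonneg_neg_iff] at this
  · intro hneg
    by_contra hlt
    have hne := h.isReflection.length_mul_left_ne u
    exact cs.geomRep_ne_zero u h.ne_zero
      (le_antisymm hneg (h.geomRep_nonneg_of_length_lt hM u (by omega)))

theorem lt_length_mul_iff (hM : M.IsSimplyLaced) (h : cs.IsPosRoot t β) (u : W) :
    cs.length u < cs.length (u * t) ↔ 0 ≤ cs.geomRep u β := by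
  refine ⟨h.geomRep_nonneg_of_length_lt hM u, fun hpos => ?_⟩
  have hne := h.isReflection.length_mul_left_ne u
  by_contra hlt
  exact cs.geomRep_ne_zero u h.ne_zero
    (le_antisymm ((h.length_mul_lt_iff hM u).1 (by omega)) hpos)

/-- A sign change would give `s_i t` length less than `1`, forcing `t = s_i`. -/
theorem geomRep_simple_nonneg (hM : M.IsSimplyLaced) (h : cs.IsPosRoot t β) {i : B}
    (hi : t ≠ cs.simple i) : 0 ≤ cs.geomRep (cs.simple i) β := by
  refine (h.geomRep_nonneg_or_nonpos hM _).resolve_right fun hneg => hi ?_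
  have := (h.length_mul_lt_iff hM _).2 hneg
  rw [length_simple, Nat.lt_one_iff, length_eq_zero_iff, mul_eq_one_iff_eq_inv'] at this
  rw [this, inv_simple]

end IsPosRoot

/-! ## Bruhat order -/

theorem BruhatLE.eq_or_length_lt {u v : W} (h : cs.BruhatLE u v) :
    u = v ∨ cs.length u < cs.length v := by
  induction h with
  | refl => exact .inl rfl
  | tail _ hstep ih =>
    obtain ⟨_, _, _, hlt⟩ := hstep
    rcases ih with rfl | ih
    · exact .inr hlt
    · exact .inr (ih.trans hlt)

theorem bruhatLT_mul_iff {t : W} (ht : cs.IsReflection t) (u : W) :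
    cs.BruhatLT u (u * t) ↔ cs.length u < cs.length (u * t) := by
  constructor
  · rintro ⟨h, hne⟩
    exact (BruhatLE.eq_or_length_lt cs h).resolve_left hne
  · intro h
    exact ⟨.single ⟨t, ht, rfl, h⟩, fun he => by rw [← he] at h; exact h.false⟩

theorem mul_bruhatLT_iff {t : W} (ht : cs.IsReflection t) (u : W) :
    cs.BruhatLT (u * t) u ↔ cs.length (u * t) < cs.length u := by
  have := cs.bruhatLT_mul_iff ht (u * t)
  rwa [mul_assoc, ht.mul_self, mul_one] at this

theorem IsPosRoot.mem_descSet_iff {cs : CoxeterSystem M W} (hM : M.IsSimplyLaced) {t : W}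
    {β : B →₀ ℝ} (h : cs.IsPosRoot t β) (u : W) : t ∈ cs.descSet u ↔ cs.geomRep u β ≤ 0 := by
  rw [← h.length_mul_lt_iff hM, ← cs.mul_bruhatLT_iff h.isReflection]
  exact and_iff_right h.isReflection

theorem IsPosRoot.mem_ascDescSet_iff {cs : CoxeterSystem M W} (hM : M.IsSimplyLaced) {t : W}
    {β : B →₀ ℝ} (h : cs.IsPosRoot t β) (u v : W) :
    t ∈ cs.ascDescSet u v ↔ 0 ≤ cs.geomRep u β ∧ cs.geomRep v β ≤ 0 := by
  rw [← h.lt_length_mul_iff hM, ← cs.bruhatLT_mul_iff h.isReflection, ← h.mem_descSet_iff hM]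
  exact and_congr_left fun _ => and_iff_right h.isReflection

/-! ## Minimal elements of `AD(u, v)` -/

/-- Some simple root has positive pairing with a given positive root. -/
theorem IsPosRoot.exists_simpleCoroot_pos {cs : CoxeterSystem M W} {t : W} {β : B →₀ ℝ}
    (h : cs.IsPosRoot t β) : ∃ i, 0 < M.simpleCoroot i β := by
  by_contra! hneg
  have h2 := h.form_self
  rw [form_apply] at h2
  have : (β.sum fun i a => a * M.simpleCoroot i β) ≤ 0 :=
    Finset.sum_nonpos fun i _ => mul_nonpos_of_nonneg_of_nonpos (h.2 i) (hneg i)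
  linarith

/-- Positive definiteness gives a value above `-2`, since a positive root is not `-α_i`; integrality
on the root lattice does the rest. -/
theorem IsPosRoot.neg_one_le_simpleCoroot {cs : CoxeterSystem M W} (hM : M.IsSimplyLaced)
    (hpd : M.IsPosDef) {t : W} {β : B →₀ ℝ} (h : cs.IsPosRoot t β) (i : B) :
    -1 ≤ M.simpleCoroot i β := by
  have hne : simpleRoot i ≠ -β := fun he => by
    have : simpleRoot i ≤ 0 := by rw [he, neg_nonpos]; exact h.2
    exact simpleRoot_ne_zero i (le_antisymm this (simpleRoot_nonneg i))
  have hlt := hpd.neg_two_lt_form (by simp [simpleCoroot_simpleRoot_self]) h.form_self hne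
  rw [form_simpleRoot] at hlt
  obtain ⟨n, hn⟩ := hM.exists_int_simpleCoroot i (h.mem_rootLattice hM)
  rw [hn] at hlt ⊢
  have : -2 < n := by exact_mod_cast hlt
  exact_mod_cast (by omega : -1 ≤ n)

theorem IsPosRoot.simpleCoroot_eq_one {cs : CoxeterSystem M W} (hM : M.IsSimplyLaced)
    (hpd : M.IsPosDef) {t : W} {β : B →₀ ℝ} (h : cs.IsPosRoot t β) {i : B}
    (hi : t ≠ cs.simple i) (hpos : 0 < M.simpleCoroot i β) : M.simpleCoroot i β = 1 := by
  have hne : simpleRoot i ≠ β := fun he =>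
    hi (h.reflection_unique hM (he ▸ cs.isPosRoot_simple i))
  have hlt := hpd.form_lt_two (by simp [simpleCoroot_simpleRoot_self]) h.form_self hne
  rw [form_simpleRoot] at hlt
  obtain ⟨n, hn⟩ := hM.exists_int_simpleCoroot i (h.mem_rootLattice hM)
  rw [hn] at hlt hpos ⊢
  have h1 : n < 2 := by exact_mod_cast hlt
  have h2 : 0 < n := by exact_mod_cast hpos
  exact_mod_cast (by omega : n = 1)

/-- If `t` is minimal in `AD(u, v)` and not simple, then every simple reflection `s` whose root has
positive pairing with the root of `t` has the properties required of `s`. -/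
theorem IsMinimalRefl.exists_simple (hM : M.IsSimplyLaced) (hpd : M.IsPosDef) {u v t : W}
    (ht : cs.IsMinimalRefl (cs.ascDescSet u v) t) (htS : t ∉ Set.range cs.simple) :
    ∃ i : B,
      cs.simple i ∈ cs.descSet t ∧
      cs.IsMinimalRefl (cs.ascDescSet (u * cs.simple i) (v * cs.simple i))
        (t * cs.simple i * t) ∧
      t * cs.simple i * t = cs.simple i * t * cs.simple i ∧
      (cs.IsRightDescent v i ↔ cs.IsRightDescent u i) := by
  obtain ⟨htX, hmin⟩ := ht
  obtain ⟨β, hβ⟩ := IsReflection.exists_isPosRoot cs htX.1.1 hM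
  obtain ⟨i, hi⟩ := hβ.exists_simpleCoroot_pos
  have hti : t ≠ cs.simple i := fun h => htS ⟨i, h.symm⟩
  have h1 := hβ.simpleCoroot_eq_one hM hpd hti hi
  have hα := cs.isPosRoot_simple i
  have hsβ : cs.geomRep (cs.simple i) β = β - simpleRoot i := by
    rw [geomRep_simple, h1, one_smul]
  have hsβ0 := hβ.geomRep_simple_nonneg hM hti
  have hsts : cs.IsPosRoot (cs.simple i * t * cs.simple i) (β - simpleRoot i) := by
    have := hβ.conj _ hsβ0
    rwa [inv_simple, hsβ] at this
  rw [hsβ] at hsβ0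
  have htα : cs.geomRep t (simpleRoot i) = simpleRoot i - β := by
    rw [hβ.geomRep_apply, M.form_comm, form_simpleRoot, h1, one_smul]
  have hrefl : t * cs.simple i * t = cs.simple i * t * cs.simple i := by
    refine IsPosRoot.reflection_unique hM ⟨⟨t * cs.simple i, i, ?_, ?_⟩, hsβ0⟩ hsts
    · simp [htX.1.1.inv, mul_assoc]
    · rw [geomRep_mul_simple_simpleRoot, htα, neg_sub]
  rw [hβ.mem_ascDescSet_iff hM] at htX
  have hdesc (w : W) : cs.IsRightDescent w i ↔ cs.geomRep w (simpleRoot i) ≤ 0 :=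
    hα.length_mul_lt_iff hM w
  have hiff : cs.IsRightDescent v i ↔ cs.IsRightDescent u i := by
    rw [hdesc, hdesc]
    constructor
    · intro hv
      -- If `uα ≥ 0`, then `s` itself lies in `AD(u,v)` below `t`.
      refine (hα.geomRep_nonneg_or_nonpos hM u).resolve_left fun hu => hti (Eq.symm ?_)
      exact hmin _ ((hα.mem_ascDescSet_iff hM u v).2 ⟨hu, hv⟩) ⟨_, _, hα, hβ, hsβ0⟩
    · intro hu
      refine (hα.geomRep_nonneg_or_nonpos hM v).resolve_left fun hv => ?_
      -- Here `uα ≤ 0 ≤ uβ` and `vβ ≤ 0 ≤ vα`, so the root `β - α` puts `sts` in `AD(u,v)`.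
      have heq := hmin _ ((hsts.mem_ascDescSet_iff hM u v).2 ⟨?_, ?_⟩)
        ⟨_, _, hsts, hβ, by simpa using simpleRoot_nonneg i⟩
      · rw [heq] at hsts
        exact simpleRoot_ne_zero i (sub_eq_self.1 (hβ.unique hsts).symm)
      · rw [map_sub]
        exact sub_nonneg.2 (hu.trans htX.1)
      · rw [map_sub]
        exact sub_nonpos.2 (htX.2.trans hv)
  refine ⟨i, ?_, ⟨?_, ?_⟩, hrefl, hiff⟩
  · rw [hα.mem_descSet_iff hM, htα]
    rwa [← neg_sub, neg_nonpos]
  · rw [hrefl, hsts.mem_ascDescSet_iff hM, geomRep_mul, geomRep_mul, ← hsβ, ← geomRep_mul _ _ _ β,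
      simple_mul_simple_self, map_one]
    exact htX
  · rw [hrefl]
    rintro r hr ⟨γ, δ, hγ, hδ, hle⟩
    rw [hδ.unique hsts] at hle
    rw [hγ.mem_ascDescSet_iff hM, geomRep_mul, geomRep_mul] at hr
    have hri : r ≠ cs.simple i := by
      rintro rfl
      rw [hγ.unique hα, geomRep_simple_simpleRoot, map_neg, map_neg, Left.nonneg_neg_iff,
        neg_nonpos] at hr
      have hv : cs.geomRep v (simpleRoot i) ≤ 0 := by rw [← hdesc, hiff, hdesc]; exact hr.1
      exact cs.geomRep_ne_zero v (simpleRoot_ne_zero i) (le_antisymm hv hr.2)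
    have hsγ := hγ.conj (cs.simple i) (hγ.geomRep_simple_nonneg hM hri)
    have heq := hmin _ ((hsγ.mem_ascDescSet_iff hM u v).2 hr) ⟨_, _, hsγ, hβ, ?_⟩
    · rw [← heq]
      simp [mul_assoc]
    · rw [geomRep_simple]
      -- `β - sγ` is `(β - α - γ) + ((α,γ) + 1)α`, a sum of two nonnegative vectors.
      have hc : 0 ≤ (M.simpleCoroot i γ + 1) • simpleRoot i :=
        smul_nonneg (by linarith [hγ.neg_one_le_simpleCoroot hM hpd i]) (simpleRoot_nonneg i)
      have := add_nonneg hle hc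
      rwa [show β - simpleRoot i - γ + (M.simpleCoroot i γ + 1) • simpleRoot i =
        β - (γ - M.simpleCoroot i γ • simpleRoot i) by module] at this

end CoxeterSystem

/-! ## Positive definiteness in types `D_n` and `E_8` -/

namespace CoxeterMatrix

variable {B : Type*} {M : CoxeterMatrix B}

/-- The entry of the Cartan matrix at a bond of multiplicity `m ∈ {1, 2, 3}`. -/
noncomputable def cartanEntry (m : ℕ) : ℝ := if m = 1 then 2 else if m = 3 then -1 else 0

theorem IsSimplyLaced.simpleCoroot_simpleRoot_eq (hM : M.IsSimplyLaced) (i j : B) :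
    M.simpleCoroot i (simpleRoot j) = cartanEntry (M i j) := by
  by_cases h : i = j
  · subst h
    rw [simpleCoroot_simpleRoot_self, M.diagonal]
    simp [cartanEntry]
  · rw [hM.simpleCoroot_simpleRoot_of_ne h, cartanEntry, if_neg (M.off_diagonal i j h)]

/-- A symmetric matrix with nonpositive off-diagonal entries is positive definite if it maps some
positive vector to a positive vector. -/
theorem sum_sum_mul_pos_of_pos_vector {ι : Type*} [Fintype ι] (a : ι → ι → ℝ)
    (hsymm : ∀ i j, a i j = a j i) (hoff : ∀ i j, i ≠ j → a i j ≤ 0) (z : ι → ℝ)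
    (hz : ∀ i, 0 < z i) (haz : ∀ i, 0 < ∑ j, a i j * z j) (x : ι → ℝ) (hx : x ≠ 0) :
    0 < ∑ i, ∑ j, x i * x j * a i j := by
  -- With `y = x / z`, the difference of the two sides is `-a_ij z_i z_j (y_i - y_j)² / 2`, which is
  -- nonnegative off the diagonal and zero on it.
  have hterm : ∀ i j, a i j * (z j * (x i ^ 2 / z i)) / 2 + a j i * (z i * (x j ^ 2 / z j)) / 2 ≤
      x i * x j * a i j := by
    intro i j
    have hi := hz i
    have hj := hz j
    by_cases h : i = j
    · subst h
      apply le_of_eq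
      field_simp
      ring
    · rw [hsymm j i]
      have h1 : x i * x j * a i j - (a i j * (z j * (x i ^ 2 / z i)) / 2 +
          a i j * (z i * (x j ^ 2 / z j)) / 2) =
            -a i j * (z i * z j * (x i / z i - x j / z j) ^ 2) / 2 := by
        field_simp
        ring
      have h2 : 0 ≤ -a i j * (z i * z j * (x i / z i - x j / z j) ^ 2) / 2 := by
        have := neg_nonneg.2 (hoff i j h)
        positivity
      linarith
  have hsum : ∑ i, ∑ j, (a i j * (z j * (x i ^ 2 / z i)) / 2 +
      a j i * (z i * (x j ^ 2 / z j)) / 2) = ∑ i, (∑ j, a i j * z j) * (x i ^ 2 / z i) := by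
    simp only [Finset.sum_add_distrib]
    rw [Finset.sum_comm (f := fun i j => a j i * (z i * (x j ^ 2 / z j)) / 2),
      ← Finset.sum_add_distrib]
    refine Finset.sum_congr rfl fun i _ => ?_
    rw [← Finset.sum_add_distrib, Finset.sum_mul]
    exact Finset.sum_congr rfl fun j _ => by ring
  refine lt_of_lt_of_le ?_ (Finset.sum_le_sum fun i _ => Finset.sum_le_sum fun j _ => hterm i j)
  rw [hsum]
  obtain ⟨k, hk⟩ := Function.ne_iff.1 hx
  refine Finset.sum_pos' (fun i _ => ?_) ⟨k, Finset.mem_univ _, ?_⟩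
  · exact mul_nonneg (haz i).le (div_nonneg (sq_nonneg _) (hz i).le)
  · exact mul_pos (haz k) (div_pos (sq_pos_of_ne_zero hk) (hz k))

theorem IsSimplyLaced.isPosDef_of_pos_vector [Fintype B] (hM : M.IsSimplyLaced) (z : B → ℝ)
    (hz : ∀ i, 0 < z i) (haz : ∀ i, 0 < ∑ j, cartanEntry (M i j) * z j) : M.IsPosDef := by
  intro x hx
  have hform : M.form x x = ∑ i, ∑ j, x i * x j * cartanEntry (M i j) := by
    rw [form_apply, Finsupp.sum_fintype _ _ (by simp)]
    refine Finset.sum_congr rfl fun i _ => ?_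
    rw [CoxeterMatrix.simpleCoroot, Finsupp.linearCombination_apply, Finsupp.sum_fintype _ _ (by simp),
      Finset.mul_sum]
    refine Finset.sum_congr rfl fun j _ => ?_
    rw [← hM.simpleCoroot_simpleRoot_eq, CoxeterMatrix.simpleCoroot_simpleRoot, smul_eq_mul,
      mul_assoc]
  rw [hform]
  refine sum_sum_mul_pos_of_pos_vector _ (fun i j => by rw [M.symmetric]) (fun i j hij => ?_) z hz
    haz x fun h => hx (DFunLike.coe_injective h)
  rcases hM i j hij with h | h <;> simp [cartanEntry, h]

theorem IsSimplyLaced.reindex {ι : Type*} {N : CoxeterMatrix ι} (hN : N.IsSimplyLaced)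
    (e : ι ≃ B) : (N.reindex e).IsSimplyLaced :=
  fun _ _ h => hN _ _ (e.symm.injective.ne h)

/-- The criterion `isPosDef_of_pos_vector` up to renaming of the simple reflections. -/
theorem IsSimplyLaced.isPosDef_reindex_of_pos_vector {ι : Type*} [Fintype ι] {N : CoxeterMatrix ι}
    (hN : N.IsSimplyLaced) (e : ι ≃ B) (z : ι → ℝ) (hz : ∀ i, 0 < z i)
    (haz : ∀ i, 0 < ∑ j, cartanEntry (N i j) * z j) : (N.reindex e).IsPosDef := by
  have := Fintype.ofEquiv ι e
  refine (hN.reindex e).isPosDef_of_pos_vector (fun b => z (e.symm b)) (fun b => hz _) fun b => ?_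
  rw [← e.sum_comp]
  simpa [CoxeterMatrix.reindex_apply] using haz (e.symm b)

theorem isSimplyLaced_E₈ : E₈.IsSimplyLaced := by
  intro i j h
  fin_cases i <;> fin_cases j <;> first | exact absurd rfl h | exact .inl rfl | exact .inr rfl

theorem isPosDef_reindex_E₈ (e : Fin 8 ≃ B) : (E₈.reindex e).IsPosDef := by
  refine isSimplyLaced_E₈.isPosDef_reindex_of_pos_vector e
    -- Coordinates of the half sum of the positive roots of `E_8`; the Cartan matrix sends them to
    -- the all-ones vector.
    ![46, 68, 91, 135, 110, 84, 57, 29] ?_ ?_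
  · intro i
    fin_cases i <;> simp
  · intro i
    rw [Fin.sum_univ_eight]
    fin_cases i <;> simp [E₈, cartanEntry] <;> norm_num

theorem isSimplyLaced_typeDMatrix (n : ℕ) : (typeDMatrix n).IsSimplyLaced := by
  intro i j h
  change (if i = j then 1 else if _ then 3 else 2) = 2 ∨ (if i = j then 1 else if _ then 3 else 2) = 3
  rw [if_neg h]
  split_ifs <;> simp

/-- The coordinates, in terms of simple roots, of half the sum of the positive roots of `D_n`. -/
noncomputable def typeDWeight (n k : ℕ) : ℝ :=
  if k ≤ 1 then (n * (n - 1) : ℝ) / 4 else (n * (n - 1) - k * (k - 1) : ℝ) / 2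

theorem typeDWeight_pos {n k : ℕ} (hn : 2 ≤ n) (hk : k < n) : 0 < typeDWeight n k := by
  have hn' : (2 : ℝ) ≤ n := by exact_mod_cast hn
  have hk' : (k : ℝ) + 1 ≤ n := by exact_mod_cast hk
  unfold typeDWeight
  split_ifs with h
  · have : 0 < (n : ℝ) * (n - 1) := mul_pos (by linarith) (by linarith)
    linarith
  · have h0 : (0 : ℝ) ≤ k := by positivity
    nlinarith

/-- Allows a missing neighbour with index `n` to be treated as a node of weight zero. -/
theorem typeDWeight_self {n : ℕ} (hn : 2 ≤ n) : typeDWeight n n = 0 := by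
  simp [typeDWeight, show ¬ n ≤ 1 by omega]

/-- Written as Kronecker deltas in `j`, so that a row sum can be evaluated term by term. The guards
remove the bond `0 — 1` and the truncated `0 - 1`. -/
theorem cartanEntry_typeDMatrix {n : ℕ} (i j : TypeDIndex n) :
    cartanEntry (typeDMatrix n i j) =
      (if (j : Fin n).1 = (i : Fin n).1 then 2 else 0) -
      (if (j : Fin n).1 = (i : Fin n).1 + 1 then if 1 ≤ (i : Fin n).1 then 1 else 0 else 0) -
      (if (j : Fin n).1 = (i : Fin n).1 - 1 then if 2 ≤ (i : Fin n).1 then 1 else 0 else 0) -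
      (if (j : Fin n).1 = 0 then if (i : Fin n).1 = 2 then 1 else 0 else 0) -
      (if (j : Fin n).1 = 2 then if (i : Fin n).1 = 0 then 1 else 0 else 0) := by
  change cartanEntry (if i = j then 1 else if typeDBond i.1 j.1 ∨ typeDBond j.1 i.1 then 3 else 2) = _
  obtain ⟨⟨i, hi⟩, hn⟩ := i
  obtain ⟨⟨j, hj⟩, hn'⟩ := j
  have h (p q : Prop) [Decidable p] [Decidable q] :
      cartanEntry (if p then 1 else if q then 3 else 2) = if p then 2 else if q then -1 else 0 := by
    split_ifs <;> simp [cartanEntry]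
  rw [h]
  simp only [Subtype.mk.injEq, Fin.mk.injEq, typeDBond]
  grind

/-- The half sum of the positive roots pairs to `1` with each simple coroot. Away from the fork this
is the constant second difference of a quadratic. -/
theorem sum_cartanEntry_typeDMatrix {n : ℕ} (i : TypeDIndex n) :
    ∑ j, cartanEntry (typeDMatrix n i j) * typeDWeight n (j : Fin n).1 = 1 := by
  have hn := i.2
  have hi := i.1.2
  have hsum (f : ℕ → ℝ) : ∑ j : TypeDIndex n, f (j : Fin n).1 = ∑ k ∈ Finset.range n, f k := by
    rw [← Fin.sum_univ_eq_sum_range]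
    exact (Equiv.subtypeUnivEquiv fun _ => hn).sum_comp fun k : Fin n => f k
  have hdelta (m : ℕ) (hm : m ≤ n) (c : ℝ) :
      ∑ j : TypeDIndex n, (if (j : Fin n).1 = m then c else 0) * typeDWeight n (j : Fin n).1 =
        c * typeDWeight n m := by
    rw [hsum fun k => (if k = m then c else 0) * typeDWeight n k]
    simp only [ite_mul, zero_mul, Finset.sum_ite_eq', Finset.mem_range]
    split_ifs with h
    · rfl
    · rw [show m = n by omega, typeDWeight_self hn, mul_zero]
  simp only [cartanEntry_typeDMatrix]
  generalize (i : Fin n).1 = k at hi ⊢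
  simp only [sub_mul, Finset.sum_sub_distrib]
  rw [hdelta _ (by omega), hdelta _ (by omega), hdelta _ (by omega), hdelta _ (by omega),
    hdelta _ (by omega)]
  obtain rfl | rfl | rfl | hk : k = 0 ∨ k = 1 ∨ k = 2 ∨ 3 ≤ k := by omega
  · simp [typeDWeight]
    ring
  · simp [typeDWeight]
    ring
  · simp [typeDWeight]
    ring
  · obtain ⟨k, rfl⟩ := Nat.exists_eq_add_of_le' hk
    simp [typeDWeight]
    ring

theorem isPosDef_reindex_typeDMatrix {n : ℕ} (e : TypeDIndex n ≃ B) :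
    ((typeDMatrix n).reindex e).IsPosDef :=
  (isSimplyLaced_typeDMatrix n).isPosDef_reindex_of_pos_vector e
    (fun i => typeDWeight n (i : Fin n).1) (fun i => typeDWeight_pos i.2 i.1.2)
    fun i => by rw [sum_cartanEntry_typeDMatrix]; exact one_pos

end CoxeterMatrix

theorem IsTypeDOrE8.isSimplyLaced {B : Type*} {M : CoxeterMatrix B} (hM : IsTypeDOrE8 M) :
    M.IsSimplyLaced := by
  rcases hM with ⟨n, e, rfl⟩ | ⟨e, rfl⟩
  · exact (CoxeterMatrix.isSimplyLaced_typeDMatrix n).reindex e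
  · exact CoxeterMatrix.isSimplyLaced_E₈.reindex e

theorem IsTypeDOrE8.isPosDef {B : Type*} {M : CoxeterMatrix B} (hM : IsTypeDOrE8 M) :
    M.IsPosDef := by
  rcases hM with ⟨n, e, rfl⟩ | ⟨e, rfl⟩
  · exact CoxeterMatrix.isPosDef_reindex_typeDMatrix e
  · exact CoxeterMatrix.isPosDef_reindex_E₈ e

/-- Here `t * s * t = s^t` and `s * t * s = t^s`. -/
theorem mainTheorem8 {B W : Type*} [Group W] {M : CoxeterMatrix B} (hM : IsTypeDOrE8 M)
    (cs : CoxeterSystem M W) (u v t : W)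
    (ht : cs.IsMinimalRefl (cs.ascDescSet u v) t) (htS : t ∉ Set.range cs.simple) :
    ∃ i : B,
      cs.simple i ∈ cs.descSet t ∧
      cs.IsMinimalRefl (cs.ascDescSet (u * cs.simple i) (v * cs.simple i))
        (t * cs.simple i * t) ∧
      t * cs.simple i * t = cs.simple i * t * cs.simple i ∧
      (cs.IsRightDescent v i ↔ cs.IsRightDescent u i) := by
  exact CoxeterSystem.IsMinimalRefl.exists_simple cs hM.isSimplyLaced hM.isPosDef ht htS
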